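/- Let $d\ge 0$. Let $X_d$ be the real unital associative algebra generated by $e_1,\dots,e_{d+2}$ subject to $e_je_k=-e_ke_j$ for distinct $j,k\le d+1$, $e_j^2=-\mathbf 1$ for $j\le d+1$, $e_{d+2}^2=0$, and $e_{d+2}e_j=e_je_{d+2}$ for $j\le d+1$. Its standard basis consists of the $2^{d+2}$ products, in increasing order of index, of distinct generators (the empty product being $\mathbf 1$). Let $i:\mathbb R^d\to X_d$ be the linear map $i(v)=\sum_{j=1}^d v_je_j$. Let $\alpha$ be the automorphism of $X_d$ that negates $e_1,\dots,e_{d+1}$ and fixes $e_{d+2}$, let $t$ be the anti-automorphism of $X_d$ that fixes every $e_j$, and put $\overline x=\alpha(t(x))$ and $N(x)=x\overline x$. Let $Z_d^0\subset X_d$ be the linear span of the products of an even number (possibly zero) of distinct elements of $\{e_1,\dots,e_d,\,e_{d+1}e_{d+2}\}$. Define $$\mathrm{Spun}(d)=\{z\in Z_d^0:\ N(z)=\mathbf 1,\ \text{and for every } v\in\mathbb R^d \text{ there is } w\in\mathbb R^d \text{ with } z(e_{d+2}i(v)+e_{d+1})\overline z=e_{d+2}i(w)+e_{d+1}\},$$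 and for $x\in\mathrm{Spun}(d)$ and $v\in\mathbb R^d$ let $v^x$ denote the (unique) such $w$ for $z=x$. For $a,p\in\mathbb R^d$ let $T_{ap}=\{x\in\mathrm{Spun}(d): a^x=p\}$, and let $\mathrm{Spun}(d)_+$ be the set of those $x\in\mathrm{Spun}(d)$ whose coefficient of $\mathbf 1$ in the standard basis is positive. Write the coordinates of $\mathbb R^{\binom{d+1}{2}}$ as $x_{j,k}$ with $1\le j<k\le d+1$. For $z\in Z_d^0$ with non-zero coefficient $c$ of $\mathbf 1$, let $\eta_d(z)\in\mathbb R^{\binom{d+1}{2}}$ be the point whose coordinate $x_{j,k}$ is, for $k\le d$, the coefficient of $e_je_k$ in $c^{-1}z$ and, for $k=d+1$, the coefficient of $e_je_{d+1}e_{d+2}$ in $c^{-1}z$. **Theorem.** For all $a,p\in\mathbb R^d$, the set $\eta_d(T_{ap}\cap\mathrm{Spun}(d)_+)$ is a (non-empty) $\binom d2$-dimensional affine subspace of $\mathbb R^{\binom{d+1}{2}}$, and it is exactly the set of solutions of the system of the $d$ equations $$a_j-p_j=\sum_{k=j+1}^{d}(a_k+p_k)\,x_{j,k}-\sum_{k=1}^{j-1}(a_k+p_k)\,x_{k,j}+2x_{j,d+1}\qquad(1\le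 j\le d).$$ -/

import Mathlib

noncomputable section

namespace SpunGroup

/-- The defining relations of the algebra `X d`, on free generators `e_1, …, e_{d+2}` (indexed from
`0` by `Fin (d + 2)`; the indices `j.castSucc` with `j : Fin (d + 1)` are those of
`e_1, …, e_{d+1}`, and `Fin.last (d + 1)` is that of `e_{d+2}`). -/
inductive Rel (d : ℕ) : FreeAlgebra ℝ (Fin (d + 2)) → FreeAlgebra ℝ (Fin (d + 2)) → Prop
  | anticomm (j k : Fin (d + 1)) (h : j ≠ k) :
      Rel d (FreeAlgebra.ι ℝ j.castSucc * FreeAlgebra.ι ℝ k.castSucc +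
        FreeAlgebra.ι ℝ k.castSucc * FreeAlgebra.ι ℝ j.castSucc) 0
  | sq (j : Fin (d + 1)) :
      Rel d (FreeAlgebra.ι ℝ j.castSucc * FreeAlgebra.ι ℝ j.castSucc + 1) 0
  | last_sq :
      Rel d (FreeAlgebra.ι ℝ (Fin.last (d + 1)) * FreeAlgebra.ι ℝ (Fin.last (d + 1))) 0
  | last_comm (j : Fin (d + 1)) :
      Rel d (FreeAlgebra.ι ℝ (Fin.last (d + 1)) * FreeAlgebra.ι ℝ j.castSucc -
        FreeAlgebra.ι ℝ j.castSucc * FreeAlgebra.ι ℝ (Fin.last (d + 1))) 0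

/-- The algebra `X_d`: the quotient of the tensor algebra of `ℝ^{d+2}` (that is, of the free algebra
on its standard basis) by the two-sided ideal generated by the relations above. -/
def X (d : ℕ) : Type := RingQuot (Rel d)

instance instRingX (d : ℕ) : Ring (X d) := inferInstanceAs (Ring (RingQuot (Rel d)))

instance instAlgebraX (d : ℕ) : Algebra ℝ (X d) := inferInstanceAs (Algebra ℝ (RingQuot (Rel d)))

/-- The quotient map onto `X_d`. -/
def mk (d : ℕ) : FreeAlgebra ℝ (Fin (d + 2)) →ₐ[ℝ] X d := RingQuot.mkAlgHom ℝ (Rel d)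

lemma mk_rel {d : ℕ} {x y : FreeAlgebra ℝ (Fin (d + 2))} (h : Rel d x y) : mk d x = mk d y :=
  RingQuot.mkAlgHom_rel ℝ h

lemma mk_surjective (d : ℕ) : Function.Surjective (mk d) :=
  RingQuot.mkAlgHom_surjective ℝ (Rel d)

/-- The generators `e_1, …, e_{d+2}` of `X_d`. -/
def e {d : ℕ} (j : Fin (d + 2)) : X d :=
  mk d (FreeAlgebra.ι ℝ j)

lemma e_anticomm {d : ℕ} {j k : Fin (d + 1)} (h : j ≠ k) :
    (e j.castSucc * e k.castSucc + e k.castSucc * e j.castSucc : X d) = 0 := by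
  simpa [e] using mk_rel (Rel.anticomm j k h)

lemma e_sq {d : ℕ} (j : Fin (d + 1)) : (e j.castSucc * e j.castSucc + 1 : X d) = 0 := by
  simpa [e] using mk_rel (Rel.sq j)

lemma e_last_sq {d : ℕ} : (e (Fin.last (d + 1)) * e (Fin.last (d + 1)) : X d) = 0 := by
  simpa [e] using mk_rel (Rel.last_sq (d := d))

lemma e_last_comm {d : ℕ} (j : Fin (d + 1)) :
    (e (Fin.last (d + 1)) * e j.castSucc - e j.castSucc * e (Fin.last (d + 1)) : X d) = 0 := by
  simpa [e] using mk_rel (Rel.last_comm j)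

/-- The universal property of `X_d`. -/
def liftX {d : ℕ} {A : Type*} [Ring A] [Algebra ℝ A] (f : Fin (d + 2) → A)
    (h₁ : ∀ j k : Fin (d + 1), j ≠ k →
      f j.castSucc * f k.castSucc + f k.castSucc * f j.castSucc = 0)
    (h₂ : ∀ j : Fin (d + 1), f j.castSucc * f j.castSucc + 1 = 0)
    (h₃ : f (Fin.last (d + 1)) * f (Fin.last (d + 1)) = 0)
    (h₄ : ∀ j : Fin (d + 1),
      f (Fin.last (d + 1)) * f j.castSucc - f j.castSucc * f (Fin.last (d + 1)) = 0) :
    X d →ₐ[ℝ] A :=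
  RingQuot.liftAlgHom ℝ ⟨FreeAlgebra.lift ℝ f, by
    intro x y h
    cases h with
    | anticomm j k h => simpa using h₁ j k h
    | sq j => simpa using h₂ j
    | last_sq => simpa using h₃
    | last_comm j => simpa using h₄ j⟩

@[simp] lemma liftX_e {d : ℕ} {A : Type*} [Ring A] [Algebra ℝ A] (f : Fin (d + 2) → A)
    (h₁ h₂ h₃ h₄) (j : Fin (d + 2)) : liftX f h₁ h₂ h₃ h₄ (e j) = f j := by
  refine (RingQuot.liftAlgHom_mkAlgHom_apply ℝ (FreeAlgebra.lift ℝ f) _ _).trans ?_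
  simp

/-- The automorphism `α` of `X_d`: it negates `e_1, …, e_{d+1}` and fixes `e_{d+2}`. -/
def alpha (d : ℕ) : X d →ₐ[ℝ] X d :=
  liftX (fun j => if j = Fin.last (d + 1) then e j else -e j)
    (fun j k h => by simpa using e_anticomm h)
    (fun j => by simpa using e_sq j)
    (by simpa using e_last_sq)
    (fun j => by
      simp only [Fin.castSucc_ne_last, if_true, if_false, mul_neg, neg_mul]
      rw [← neg_add', ← sub_eq_add_neg, e_last_comm, neg_zero])

/-- The anti-automorphism `t` of `X_d` that fixes all generators, as a homomorphism to the opposite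
algebra. -/
def revOp (d : ℕ) : X d →ₐ[ℝ] (X d)ᵐᵒᵖ :=
  liftX (fun j => MulOpposite.op (e j))
    (fun j k h => by
      rw [← MulOpposite.op_mul, ← MulOpposite.op_mul, ← MulOpposite.op_add, add_comm,
        add_comm, e_anticomm h.symm, MulOpposite.op_zero])
    (fun j => by
      rw [← MulOpposite.op_mul, ← MulOpposite.op_one, ← MulOpposite.op_add, e_sq,
        MulOpposite.op_zero])
    (by rw [← MulOpposite.op_mul, e_last_sq, MulOpposite.op_zero])
    (fun j => by
      rw [← MulOpposite.op_mul, ← MulOpposite.op_mul, ← MulOpposite.op_sub, ← neg_sub,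
        e_last_comm, neg_zero, MulOpposite.op_zero])

/-- The anti-automorphism `t` of `X_d`. -/
def rev {d : ℕ} (x : X d) : X d := MulOpposite.unop (revOp d x)

/-- The conjugate `x̄ = α(t(x))`. -/
def conj {d : ℕ} (x : X d) : X d := alpha d (rev x)

/-- The norm `N(x) = x x̄`, an element of `X_d`. -/
def N {d : ℕ} (x : X d) : X d := x * conj x

/-- The standard monomial `e_{s_1} e_{s_2} ⋯ e_{s_m}` of a set `S = {s_1 < ⋯ < s_m}` of indices. -/
def mono {d : ℕ} (S : Finset (Fin (d + 2))) : X d := (S.sort.map e).prod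

/-! ### The standard monomials form a basis -/

lemma mono_empty {d : ℕ} : (mono ∅ : X d) = 1 := by simp [mono]

lemma mono_insert {d : ℕ} {a : Fin (d + 2)} {S : Finset (Fin (d + 2))} (h : ∀ b ∈ S, a < b) :
    (mono (insert a S) : X d) = e a * mono S := by
  rw [mono, Finset.sort_insert _ (fun b hb => (h b hb).le) (fun ha => lt_irrefl _ (h a ha))]
  simp [mono]

lemma e_swap {d : ℕ} (j k : Fin (d + 2)) (h : j ≠ k) :
    ∃ c : ℝ, (e j * e k : X d) = c • (e k * e j) := by
  induction j using Fin.lastCases with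
  | last =>
    induction k using Fin.lastCases with
    | last => exact absurd rfl h
    | cast k => exact ⟨1, by rw [one_smul]; exact sub_eq_zero.1 (e_last_comm k)⟩
  | cast j =>
    induction k using Fin.lastCases with
    | last => exact ⟨1, by rw [one_smul]; exact (sub_eq_zero.1 (e_last_comm j)).symm⟩
    | cast k =>
      refine ⟨-1, ?_⟩
      rw [neg_one_smul]
      exact eq_neg_of_add_eq_zero_left (e_anticomm fun hjk => h (by rw [hjk]))

lemma e_mul_self {d : ℕ} (j : Fin (d + 2)) : ∃ c : ℝ, (e j * e j : X d) = c • 1 := by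
  induction j using Fin.lastCases with
  | last => exact ⟨0, by rw [zero_smul, e_last_sq]⟩
  | cast j => exact ⟨-1, by rw [neg_one_smul]; exact eq_neg_of_add_eq_zero_left (e_sq j)⟩

lemma e_mul_mono {d : ℕ} (j : Fin (d + 2)) (S : Finset (Fin (d + 2))) :
    ∃ c : ℝ, (e j * mono S : X d) = c • mono (symmDiff S {j}) := by
  induction S using Finset.induction_on_min with
  | empty =>
    refine ⟨1, ?_⟩
    have : symmDiff (∅ : Finset (Fin (d + 2))) {j} = insert j ∅ := by ext x; simp [Finset.mem_symmDiff]
    rw [this, mono_insert (by simp), one_smul]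
  | insert a S h ih =>
    rw [mono_insert h]
    have haS : a ∉ S := fun ha => lt_irrefl _ (h a ha)
    rcases lt_trichotomy j a with hj | rfl | hj
    · refine ⟨1, ?_⟩
      have hj' : ∀ b ∈ insert a S, j < b := by
        intro b hb
        rcases Finset.mem_insert.1 hb with rfl | hb
        · exact hj
        · exact hj.trans (h b hb)
      have : symmDiff (insert a S) {j} = insert j (insert a S) := by
        ext x
        have : x = j → x ∉ insert a S := by
          rintro rfl hx
          exact lt_irrefl _ (hj' _ hx)
        simp only [Finset.mem_symmDiff, Finset.mem_singleton, Finset.mem_insert] at this ⊢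
        tauto
      rw [this, mono_insert hj', mono_insert h, one_smul]
    · obtain ⟨c, hc⟩ := e_mul_self j
      refine ⟨c, ?_⟩
      have : symmDiff (insert j S) {j} = S := by
        ext x
        have : x = j → x ∉ S := by
          rintro rfl
          exact haS
        simp only [Finset.mem_symmDiff, Finset.mem_singleton, Finset.mem_insert]
        tauto
      rw [this, ← mul_assoc, hc, smul_mul_assoc, one_mul]
    · obtain ⟨c, hc⟩ := ih
      obtain ⟨c', hc'⟩ := e_swap j a hj.ne'
      refine ⟨c' * c, ?_⟩
      have h1 : symmDiff (insert a S) {j} = insert a (symmDiff S {j}) := by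
        ext x
        have : x = a → x ≠ j := by
          rintro rfl
          exact hj.ne
        simp only [Finset.mem_symmDiff, Finset.mem_singleton, Finset.mem_insert]
        tauto
      have h2 : ∀ b ∈ symmDiff S {j}, a < b := by
        intro b hb
        simp only [Finset.mem_symmDiff, Finset.mem_singleton] at hb
        rcases hb with hb | hb
        · exact h b hb.1
        · rw [hb.1]; exact hj
      rw [h1, mono_insert h2, ← mul_assoc, hc', smul_mul_assoc, mul_assoc, hc, mul_smul_comm,
        smul_smul]

lemma span_mono (d : ℕ) : ⊤ ≤ Submodule.span ℝ (Set.range (mono : _ → X d)) := by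
  set W := Submodule.span ℝ (Set.range (mono : _ → X d)) with hW
  have he : ∀ (j : Fin (d + 2)) (w : X d), w ∈ W → e j * w ∈ W := by
    intro j w hw
    induction hw using Submodule.span_induction with
    | mem w hw =>
      obtain ⟨S, rfl⟩ := hw
      obtain ⟨c, hc⟩ := e_mul_mono j S
      rw [hc]
      exact W.smul_mem _ (Submodule.subset_span ⟨_, rfl⟩)
    | zero => simp
    | add x y _ _ hx hy => rw [mul_add]; exact W.add_mem hx hy
    | smul c x _ hx => rw [mul_smul_comm]; exact W.smul_mem _ hx
  have key : ∀ (z : FreeAlgebra ℝ (Fin (d + 2))) (w : X d), w ∈ W →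
      mk d z * w ∈ W := by
    intro z
    induction z using FreeAlgebra.induction with
    | grade0 r =>
      intro w hw
      rw [AlgHom.commutes, ← Algebra.smul_def]
      exact W.smul_mem _ hw
    | grade1 j => exact he j
    | mul a b ha hb =>
      intro w hw
      rw [map_mul, mul_assoc]
      exact ha _ (hb _ hw)
    | add a b ha hb =>
      intro w hw
      rw [map_add, add_mul]
      exact W.add_mem (ha _ hw) (hb _ hw)
  intro x _
  obtain ⟨z, rfl⟩ := mk_surjective d x
  simpa using key z 1 (Submodule.subset_span ⟨∅, mono_empty⟩)

/-- The coefficient of the monomial of `S` in `e_j` times the monomial of `symmDiff S {j}`. -/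
def regCoeff {d : ℕ} (j : Fin (d + 2)) (S : Finset (Fin (d + 2))) : ℝ :=
  if j = Fin.last (d + 1) then (if j ∈ S then 1 else 0)
  else (∏ k ∈ S, if k < j then -1 else 1) * (if j ∈ S then 1 else -1)

/-- Left multiplication by `e_j`, in coordinates. -/
def regOp {d : ℕ} (j : Fin (d + 2)) : Module.End ℝ (Finset (Fin (d + 2)) → ℝ) where
  toFun g S := regCoeff j S * g (symmDiff S {j})
  map_add' g h := by ext S; simp [mul_add]
  map_smul' c g := by ext S; simp; ring

lemma prod_symmDiff {n : ℕ} (f : Fin n → ℝ) (hf : ∀ k, f k * f k = 1) (S : Finset (Fin n))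
    (j : Fin n) : ∏ k ∈ symmDiff S {j}, f k = f j * ∏ k ∈ S, f k := by
  by_cases h : j ∈ S
  · have : symmDiff S {j} = S.erase j := by
      ext x
      simp only [Finset.mem_symmDiff, Finset.mem_singleton, Finset.mem_erase]
      have : x = j → x ∈ S := by rintro rfl; exact h
      tauto
    rw [this, ← Finset.mul_prod_erase S f h, ← mul_assoc, hf, one_mul]
  · have : symmDiff S {j} = insert j S := by
      ext x
      simp only [Finset.mem_symmDiff, Finset.mem_singleton, Finset.mem_insert]
      have : x = j → x ∉ S := by rintro rfl; exact h
      tauto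
    rw [this, Finset.prod_insert h]

lemma mem_symmDiff_self {n : ℕ} (S : Finset (Fin n)) (j : Fin n) :
    j ∈ symmDiff S {j} ↔ j ∉ S := by
  simp [Finset.mem_symmDiff]

lemma mem_symmDiff_ne {n : ℕ} (S : Finset (Fin n)) {j k : Fin n} (h : j ≠ k) :
    j ∈ symmDiff S {k} ↔ j ∈ S := by
  simp [Finset.mem_symmDiff, h]

lemma sign_sq {n : ℕ} (j k : Fin n) :
    (if k < j then (-1 : ℝ) else 1) * (if k < j then -1 else 1) = 1 := by
  split_ifs <;> norm_num

/-- The left regular representation of `X_d`, in coordinates. -/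
def reg (d : ℕ) : X d →ₐ[ℝ] Module.End ℝ (Finset (Fin (d + 2)) → ℝ) :=
  liftX regOp
    (by
      intro j k h
      have hne : j.castSucc ≠ k.castSucc := fun h' => h (Fin.castSucc_injective _ h')
      refine LinearMap.ext fun g => ?_
      funext S
      simp only [regOp, LinearMap.add_apply, Module.End.mul_apply, LinearMap.coe_mk,
        AddHom.coe_mk, Pi.add_apply, LinearMap.zero_apply, Pi.zero_apply, regCoeff,
        Fin.castSucc_ne_last, if_false, mem_symmDiff_ne S hne, mem_symmDiff_ne S hne.symm]
      rw [prod_symmDiff _ (sign_sq _), prod_symmDiff _ (sign_sq _),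
        symmDiff_right_comm S {k.castSucc} {j.castSucc}]
      rcases lt_or_gt_of_ne hne with h' | h'
      · simp only [h', h'.not_gt, if_true, if_false]
        ring
      · simp only [h', h'.not_gt, if_true, if_false]
        ring)
    (by
      intro j
      refine LinearMap.ext fun g => ?_
      funext S
      simp only [regOp, LinearMap.add_apply, Module.End.mul_apply, LinearMap.coe_mk,
        AddHom.coe_mk, Pi.add_apply, LinearMap.zero_apply, Pi.zero_apply, regCoeff,
        Fin.castSucc_ne_last, if_false, mem_symmDiff_self, Module.End.one_apply]
      rw [prod_symmDiff _ (sign_sq _), symmDiff_symmDiff_cancel_right]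
      have h1 : (∏ k ∈ S, if k < j.castSucc then (-1 : ℝ) else 1) *
          (∏ k ∈ S, if k < j.castSucc then (-1 : ℝ) else 1) = 1 := by
        rw [← Finset.prod_mul_distrib]
        exact Finset.prod_eq_one fun k _ => sign_sq _ _
      by_cases hS : j.castSucc ∈ S
      · simp only [hS, lt_irrefl, if_true, if_false, not_true]
        linear_combination (-(g S)) * h1
      · simp only [hS, lt_irrefl, if_true, if_false, not_false_iff]
        linear_combination (-(g S)) * h1)
    (by
      refine LinearMap.ext fun g => ?_
      funext S
      simp only [regOp, Module.End.mul_apply, LinearMap.coe_mk, AddHom.coe_mk,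
        LinearMap.zero_apply, Pi.zero_apply, regCoeff, if_true, mem_symmDiff_self]
      by_cases hS : Fin.last (d + 1) ∈ S <;> simp [hS])
    (by
      intro j
      have hne : j.castSucc ≠ Fin.last (d + 1) := Fin.castSucc_ne_last j
      refine LinearMap.ext fun g => ?_
      funext S
      simp only [regOp, LinearMap.sub_apply, Module.End.mul_apply, LinearMap.coe_mk,
        AddHom.coe_mk, Pi.sub_apply, LinearMap.zero_apply, Pi.zero_apply, regCoeff,
        hne, if_false, if_true, mem_symmDiff_ne S hne, mem_symmDiff_ne S hne.symm]
      rw [prod_symmDiff _ (sign_sq _), symmDiff_right_comm S {j.castSucc} {Fin.last (d + 1)}]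
      simp only [(Fin.le_last j.castSucc).not_gt, if_false]
      ring)

lemma reg_mono {d : ℕ} (S : Finset (Fin (d + 2))) :
    reg d (mono S) (Pi.single ∅ 1) = Pi.single S 1 := by
  induction S using Finset.induction_on_min with
  | empty => simp [mono_empty]
  | insert a S h ih =>
    have haS : a ∉ S := fun ha => lt_irrefl _ (h a ha)
    rw [mono_insert h, map_mul, Module.End.mul_apply, ih]
    funext U
    simp only [reg, liftX_e, regOp, LinearMap.coe_mk, AddHom.coe_mk]
    have hSa : symmDiff S {a} = insert a S := by
      ext x
      simp only [Finset.mem_symmDiff, Finset.mem_singleton, Finset.mem_insert]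
      have : x = a → x ∉ S := by rintro rfl; exact haS
      tauto
    by_cases hU : U = insert a S
    · subst hU
      have h1 : symmDiff (insert a S) {a} = S := by
        rw [← hSa, symmDiff_symmDiff_cancel_right]
      rw [h1, Pi.single_eq_same, Pi.single_eq_same, mul_one, regCoeff]
      have h2 : (∏ k ∈ insert a S, if k < a then (-1 : ℝ) else 1) = 1 := by
        refine Finset.prod_eq_one fun k hk => if_neg ?_
        rcases Finset.mem_insert.1 hk with rfl | hk
        · exact lt_irrefl _
        · exact (h k hk).not_gt
      simp [h2]
    · have h1 : symmDiff U {a} ≠ S := by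
        rintro rfl
        rw [symmDiff_symmDiff_cancel_right] at hSa
        exact hU hSa
      rw [Pi.single_eq_of_ne h1, Pi.single_eq_of_ne hU, mul_zero]

lemma linearIndependent_mono (d : ℕ) : LinearIndependent ℝ (mono : _ → X d) := by
  refine LinearIndependent.of_comp
    ((LinearMap.applyₗ (Pi.single ∅ 1)).comp (reg d).toLinearMap) ?_
  have : (((LinearMap.applyₗ (Pi.single ∅ 1)).comp (reg d).toLinearMap) ∘ (mono : _ → X d)) =
      Pi.basisFun ℝ (Finset (Fin (d + 2))) := by
    funext S
    simp [reg_mono]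
  rw [this]
  exact (Pi.basisFun ℝ (Finset (Fin (d + 2)))).linearIndependent

/-- The standard basis of `X_d`: the products of distinct generators. -/
def stdBasis (d : ℕ) : Module.Basis (Finset (Fin (d + 2))) ℝ (X d) :=
  Module.Basis.mk (linearIndependent_mono d) (span_mono d)

/-- The coefficient in `x` of the standard basis element of `S`. -/
def coeff {d : ℕ} (S : Finset (Fin (d + 2))) (x : X d) : ℝ := (stdBasis d).repr x S

/-! ### The group `Spun(d)` -/

/-- `e_{d+1}`. -/
def eA (d : ℕ) : X d := e (Fin.last d).castSucc

/-- `e_{d+2}`. -/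
def eB (d : ℕ) : X d := e (Fin.last (d + 1))

/-- The linear map `i : ℝ^d → X_d` that takes the standard basis to `e_1, …, e_d`. -/
def i {d : ℕ} : EuclideanSpace ℝ (Fin d) →ₗ[ℝ] X d where
  toFun v := ∑ j : Fin d, v j • e j.castSucc.castSucc
  map_add' v w := by simp [add_smul, Finset.sum_add_distrib]
  map_smul' c v := by simp [Finset.smul_sum, smul_smul]

/-- The `d + 1` elements `e_1, …, e_d, e_{d+1} e_{d+2}`. -/
def zGen {d : ℕ} (j : Fin (d + 1)) : X d :=
  if j = Fin.last d then eA d * eB d else e j.castSucc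

/-- The subspace `Z_d^0` generated by the products of an even number of distinct elements of
`{e_1, …, e_d, e_{d+1} e_{d+2}}` (the empty product is `1`). -/
def Z (d : ℕ) : Submodule ℝ (X d) :=
  Submodule.span ℝ {x | ∃ S : Finset (Fin (d + 1)), Even S.card ∧ x = (S.sort.map zGen).prod}

/-- The group `Spun(d)`, as a subset of `X_d`. -/
def Spun (d : ℕ) : Set (X d) :=
  {z | z ∈ Z d ∧ N z = 1 ∧ ∀ v : EuclideanSpace ℝ (Fin d), ∃ w : EuclideanSpace ℝ (Fin d),
    z * (eB d * i v + eA d) * conj z = eB d * i w + eA d}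

/-- The map `τ`, with `τ (e_{d+2} i(v) + e_{d+1}) = v` (see `tau_apply`): the `j`-th coordinate is
the coefficient of `e_j e_{d+2}`. -/
def tau {d : ℕ} (x : X d) : EuclideanSpace ℝ (Fin d) :=
  WithLp.toLp 2 fun j => coeff {j.castSucc.castSucc, Fin.last (d + 1)} x

/-- The action `w^x = τ (x (e_{d+2} i(w) + e_{d+1}) x̄)` of `x ∈ Spun(d)` on `ℝ^d`. -/
def act {d : ℕ} (x : X d) (w : EuclideanSpace ℝ (Fin d)) : EuclideanSpace ℝ (Fin d) :=
  tau (x * (eB d * i w + eA d) * conj x)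

/-- `T_{ap}`: the elements of `Spun(d)` whose action takes `a` to `p`. -/
def T {d : ℕ} (a p : EuclideanSpace ℝ (Fin d)) : Set (X d) := {x | x ∈ Spun d ∧ act x a = p}

/-- `Spun(d)_+`: the elements of `Spun(d)` in which the coefficient of `1` is positive. -/
def SpunPos (d : ℕ) : Set (X d) := {x | x ∈ Spun d ∧ 0 < coeff ∅ x}

/-! ### The map `η_d` -/

/-- The pairs `j < k` in `{1, …, d+1}` (indexed from `0`). -/
abbrev Pair (d : ℕ) : Type := {q : Fin (d + 1) × Fin (d + 1) // q.1 < q.2}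

/-- The set of generators in the 2-term with index `j < k`: this 2-term is `e_j e_k` when `k ≤ d`,
and `e_j e_{d+1} e_{d+2}` when `k = d + 1` (see `mono_twoTerm`). -/
def twoTerm {d : ℕ} (q : Pair d) : Finset (Fin (d + 2)) :=
  if q.1.2 = Fin.last d then {q.1.1.castSucc, q.1.2.castSucc, Fin.last (d + 1)}
  else {q.1.1.castSucc, q.1.2.castSucc}

/-- The map `η_d` on elements with non-zero coefficient of `1`: rescale the element so that the
coefficient of `1` becomes `1`, and keep the coefficients of the 2-terms. -/
def eta {d : ℕ} (x : X d) : EuclideanSpace ℝ (Pair d) :=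
  WithLp.toLp 2 fun q => coeff (twoTerm q) ((coeff ∅ x)⁻¹ • x)

/-! ### Checks of the coordinates -/

lemma coeff_mono {d : ℕ} (S U : Finset (Fin (d + 2))) :
    coeff S (mono U : X d) = if U = S then 1 else 0 := by
  have : (mono U : X d) = stdBasis d U := by simp [stdBasis]
  rw [coeff, this, Module.Basis.repr_self, Finsupp.single_apply]

lemma mono_pair {d : ℕ} {j k : Fin (d + 2)} (h : j < k) : (mono {j, k} : X d) = e j * e k := by
  have hk : ({k} : Finset (Fin (d + 2))) = insert k ∅ := rfl
  rw [mono_insert (by simpa using h), hk, mono_insert (by simp), mono_empty, mul_one]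

lemma mono_twoTerm {d : ℕ} (q : Pair d) : (mono (twoTerm q) : X d) = zGen q.1.1 * zGen q.1.2 := by
  obtain ⟨⟨j, k⟩, h⟩ := q
  have h : j < k := h
  have hj : j ≠ Fin.last d := (h.trans_le (Fin.le_last k)).ne
  have hjk : j.castSucc < k.castSucc := h
  by_cases hk : k = Fin.last d
  · subst hk
    simp only [twoTerm, zGen, hj, if_true, if_false, eA, eB]
    rw [mono_insert, mono_pair (Fin.castSucc_lt_last _)]
    intro b hb
    rcases Finset.mem_insert.1 hb with rfl | hb
    · exact hjk
    · rw [Finset.mem_singleton.1 hb]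
      exact Fin.castSucc_lt_last _
  · simp only [twoTerm, zGen, hj, hk, if_false]
    exact mono_pair hjk

lemma tau_apply {d : ℕ} (v : EuclideanSpace ℝ (Fin d)) : tau (eB d * i v + eA d) = v := by
  have hA : eA d = mono {(Fin.last d).castSucc} := by
    rw [← insert_empty_eq, mono_insert (by simp), mono_empty, mul_one]; rfl
  have hB : eB d * i v = ∑ k : Fin d, v k • mono {k.castSucc.castSucc, Fin.last (d + 1)} := by
    change eB d * ∑ k : Fin d, v k • e k.castSucc.castSucc = _
    rw [Finset.mul_sum]
    refine Finset.sum_congr rfl fun k _ => ?_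
    rw [mul_smul_comm, mono_pair (Fin.castSucc_lt_last _), eB,
      sub_eq_zero.1 (e_last_comm k.castSucc)]
  ext j
  have hinj : ∀ k : Fin d, ({k.castSucc.castSucc, Fin.last (d + 1)} : Finset (Fin (d + 2))) =
      {j.castSucc.castSucc, Fin.last (d + 1)} ↔ k = j := by
    intro k
    constructor
    · intro h
      have : k.castSucc.castSucc ∈
          ({j.castSucc.castSucc, Fin.last (d + 1)} : Finset (Fin (d + 2))) := by rw [← h]; simp
      simpa [Fin.castSucc_ne_last] using this
    · rintro rfl; rfl
  have hne : ({(Fin.last d).castSucc} : Finset (Fin (d + 2))) ≠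
      {j.castSucc.castSucc, Fin.last (d + 1)} := by
    intro h
    have : Fin.last (d + 1) ∈ ({(Fin.last d).castSucc} : Finset (Fin (d + 2))) := by rw [h]; simp
    exact Fin.castSucc_ne_last _ (Finset.mem_singleton.1 this).symm
  have hc : ∀ S (x y : X d), coeff S (x + y) = coeff S x + coeff S y := by simp [coeff]
  have hs : ∀ S, coeff S (∑ k : Fin d, v k • mono {k.castSucc.castSucc, Fin.last (d + 1)} : X d) =
      ∑ k : Fin d, v k * coeff S (mono {k.castSucc.castSucc, Fin.last (d + 1)} : X d) := by
    intro S; simp [coeff, Finsupp.finsetSum_apply]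
  simp only [tau]
  rw [hc, hA, hB, hs, coeff_mono, if_neg hne, add_zero]
  simp [coeff_mono, hinj]

end SpunGroup

end

namespace SpunGroup

variable {d : ℕ}

/-! ### Conjugation -/

/-! An element `z` with `N z = 1` is invertible with inverse `conj z`, so it takes `a` to `p`
exactly when `z (e_{d+2} a + e_{d+1}) = (e_{d+2} p + e_{d+1}) z`. As `e_{d+2}` is central, this says
`e_{d+1} z - z e_{d+1} = (z a - p z) e_{d+2}`. Only the coefficient of `1` and those of the 2-terms
of `z` enter the coefficient of `e_j e_{d+2}` here, and they enter linearly; dividing by the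
coefficient of `1` gives the system (`transport_equation`, `systemMap_eta`).

Conversely, let `x` solve the system. Some even Clifford element `s` of `ℝ^d` acts as a rotation up
to scale, has coefficient `1` at `1`, and has the coordinates `x_{j,k}`, `k ≤ d`, as coefficients of
the `e_j e_k` (`exists_isRotor`). Composing with a suitable translation and normalizing gives an
element of `T a p` (`IsRotor.exists_smul_translator_mul_mem_T`), and neither operation alters the
ratios of these coefficients to that of `1`. The remaining coordinates `x_{j,d+1}` need no
construction: each occurs in just one equation, with coefficient 2, so the system determines them
from the others (`eta_image`).

For the same reason the system has rank `d`, and its solution space has dimension `(d+1).choose 2 -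
d = d.choose 2`. -/

lemma conj_mul (x y : X d) : conj (x * y) = conj y * conj x := by
  simp [conj, rev]

lemma conj_add (x y : X d) : conj (x + y) = conj x + conj y := by
  simp [conj, rev]

lemma conj_smul (c : ℝ) (x : X d) : conj (c • x) = c • conj x := by
  simp [conj, rev]

lemma conj_one : conj (1 : X d) = 1 := by
  simp [conj, rev]

lemma conj_e_castSucc (j : Fin (d + 1)) : conj (e j.castSucc : X d) = -e j.castSucc := by
  simp [conj, rev, revOp, alpha]

lemma conj_eA : conj (eA d) = -eA d := conj_e_castSucc _

lemma conj_eB : conj (eB d) = eB d := by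
  simp [conj, rev, revOp, alpha, eB]

lemma i_apply (v : EuclideanSpace ℝ (Fin d)) :
    (i v : X d) = ∑ j : Fin d, v j • e j.castSucc.castSucc := rfl

lemma i_single (m : Fin d) :
    (i (EuclideanSpace.single m (1 : ℝ)) : X d) = e m.castSucc.castSucc := by
  simp [i_apply]

lemma conj_i (v : EuclideanSpace ℝ (Fin d)) : conj (i v : X d) = -i v := by
  have h : ∀ s : Finset (Fin d), conj (∑ j ∈ s, v j • e j.castSucc.castSucc : X d) =
      -∑ j ∈ s, v j • e j.castSucc.castSucc := by
    intro s
    induction s using Finset.induction_on with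
    -- That `conj 0 = 0` is obtained by scaling with `0`, since `conj` is a bare function.
    | empty => simpa using conj_smul (0 : ℝ) (0 : X d)
    | insert a s ha ih =>
      rw [Finset.sum_insert ha, conj_add, ih, conj_smul, conj_e_castSucc, smul_neg, neg_add]
  rw [i_apply]
  exact h _

/-! ### Commutation relations -/

lemma eB_comm (x : X d) : eB d * x = x * eB d := by
  obtain ⟨z, rfl⟩ := mk_surjective d x
  induction z using FreeAlgebra.induction with
  | grade0 r => rw [AlgHom.commutes, Algebra.commutes]
  | grade1 j =>
    induction j using Fin.lastCases with
    | last => rfl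
    | cast j => exact sub_eq_zero.1 (e_last_comm j)
  | mul a b ha hb => rw [map_mul, ← mul_assoc, ha, mul_assoc, hb, mul_assoc]
  | add a b ha hb => rw [map_add, mul_add, add_mul, ha, hb]

lemma eB_sq : eB d * eB d = 0 := e_last_sq

lemma eA_sq : eA d * eA d = -1 := eq_neg_of_add_eq_zero_left (e_sq _)

lemma eA_mul_i (v : EuclideanSpace ℝ (Fin d)) : eA d * i v = -(i v * eA d) := by
  rw [i_apply, Finset.mul_sum, Finset.sum_mul, ← Finset.sum_neg_distrib]
  refine Finset.sum_congr rfl fun j _ => ?_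
  rw [mul_smul_comm, smul_mul_assoc, ← smul_neg]
  congr 1
  exact eq_neg_of_add_eq_zero_left (e_anticomm (Fin.castSucc_lt_last j).ne')

/-- The Clifford relation. -/
lemma i_mul_i_add (v w : EuclideanSpace ℝ (Fin d)) :
    (i v * i w + i w * i v : X d) = (-2 * inner ℝ v w) • 1 := by
  have h : ∀ j k : Fin d, (e j.castSucc.castSucc * e k.castSucc.castSucc +
      e k.castSucc.castSucc * e j.castSucc.castSucc : X d) = if j = k then (-2 : ℝ) • 1 else 0 := by
    intro j k
    split_ifs with hjk
    · subst hjk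
      rw [eq_neg_of_add_eq_zero_left (e_sq j.castSucc), neg_smul, two_smul, neg_add]
    · exact e_anticomm fun h => hjk (Fin.castSucc_injective _ h)
  have h1 : (i v * i w : X d) = ∑ j, ∑ k, (v j * w k) •
      (e j.castSucc.castSucc * e k.castSucc.castSucc) := by
    simp only [i_apply, Finset.sum_mul_sum, smul_mul_smul_comm]
  have h2 : (i w * i v : X d) = ∑ j, ∑ k, (v j * w k) •
      (e k.castSucc.castSucc * e j.castSucc.castSucc) := by
    simp only [i_apply, Finset.sum_mul_sum, smul_mul_smul_comm]
    rw [Finset.sum_comm]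
    simp only [mul_comm (w _)]
  rw [h1, h2, ← Finset.sum_add_distrib]
  simp only [← Finset.sum_add_distrib, ← smul_add, h, smul_ite, smul_zero, Finset.sum_ite_eq,
    Finset.mem_univ, if_true, smul_smul, ← Finset.sum_smul, PiLp.inner_apply, Finset.mul_sum]
  congr 1
  refine Finset.sum_congr rfl fun j _ => ?_
  simp
  ring

lemma i_mul_self (v : EuclideanSpace ℝ (Fin d)) : (i v * i v : X d) = (-inner ℝ v v) • 1 := by
  have h := i_mul_i_add v v
  rw [← two_smul ℝ, mul_comm (-2 : ℝ), mul_neg, ← neg_mul, mul_comm, mul_smul] at h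
  exact smul_right_injective _ (two_ne_zero : (2 : ℝ) ≠ 0) h

lemma i_mul_swap (v w : EuclideanSpace ℝ (Fin d)) :
    (i v * i w : X d) = (-2 * inner ℝ v w) • 1 - i w * i v := eq_sub_of_add_eq (i_mul_i_add v w)

/-- Up to the factor `|w|²`, this is the reflection in the hyperplane orthogonal to `w`; it follows
by swapping the first two factors and using `w² = -|w|²`. -/
lemma i_sandwich (w v : EuclideanSpace ℝ (Fin d)) :
    (i w * i v * i w : X d) = i ((inner ℝ w w) • v - (2 * inner ℝ w v) • w) := by
  rw [i_mul_swap, sub_mul, mul_assoc, i_mul_self]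
  simp only [map_sub, map_smul, smul_mul_assoc, one_mul, mul_smul_comm, mul_one, neg_smul,
    neg_mul, mul_neg]
  rw [sub_neg_eq_add, neg_add_eq_sub]

/-- The conjugation by the unnormalized rotor `1 + wf`. -/
lemma rotor_sandwich (w f v : EuclideanSpace ℝ (Fin d)) :
    ∃ u, ((1 + i w * i f) * i v * (1 + i f * i w) : X d) = i u := by
  -- The three summands are `v`, the cross terms `wfv + vfw`, and `w(fvf)w`, the last being a double
  -- application of `i_sandwich`.
  refine ⟨v + ((-2 * inner ℝ f v) • w + (2 * inner ℝ w v) • f - (2 * inner ℝ w f) • v) +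
    ((inner ℝ w w) • ((inner ℝ f f) • v - (2 * inner ℝ f v) • f) -
    (2 * inner ℝ w ((inner ℝ f f) • v - (2 * inner ℝ f v) • f)) • w), ?_⟩
  have h1 : (i w * i f * i v + i v * i f * i w : X d) =
      i ((-2 * inner ℝ f v) • w + (2 * inner ℝ w v) • f - (2 * inner ℝ w f) • v) := by
    -- The cross terms are rewritten through anticommutators, which are scalars, so that only
    -- vectors remain.
    have h2 : (i w * i f * i v + i v * i f * i w : X d) =
        i w * (i f * i v + i v * i f) - (i w * i v + i v * i w) * i f +
          i v * (i w * i f + i f * i w) := by noncomm_ring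
    rw [h2, i_mul_i_add, i_mul_i_add, i_mul_i_add]
    simp only [map_sub, map_add, map_smul, smul_mul_assoc, one_mul, mul_smul_comm, mul_one,
      neg_smul, neg_mul, mul_neg, map_neg]
    abel
  rw [map_add, map_add, ← h1, ← i_sandwich w, ← i_sandwich f]
  noncomm_ring

/-! ### Coefficients of products -/

lemma coeff_add (S : Finset (Fin (d + 2))) (x y : X d) :
    coeff S (x + y) = coeff S x + coeff S y := by simp [coeff]

lemma coeff_sub (S : Finset (Fin (d + 2))) (x y : X d) :
    coeff S (x - y) = coeff S x - coeff S y := by simp [coeff]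

lemma coeff_smul (S : Finset (Fin (d + 2))) (c : ℝ) (x : X d) :
    coeff S (c • x) = c * coeff S x := by simp [coeff]

lemma coeff_sum {ι : Type*} (S : Finset (Fin (d + 2))) (s : Finset ι) (f : ι → X d) :
    coeff S (∑ k ∈ s, f k) = ∑ k ∈ s, coeff S (f k) := by
  simp [coeff, Finsupp.finsetSum_apply]

lemma mono_induction {P : X d → Prop} (hmono : ∀ S, P (mono S))
    (hadd : ∀ x y, P x → P y → P (x + y)) (hsmul : ∀ (c : ℝ) x, P x → P (c • x)) (x : X d) :
    P x := by
  have hx := span_mono d (Submodule.mem_top : x ∈ ⊤)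
  induction hx using Submodule.span_induction with
  | mem x hx => obtain ⟨S, rfl⟩ := hx; exact hmono S
  | zero => simpa using hsmul 0 _ (hmono ∅)
  | add x y _ _ hx hy => exact hadd x y hx hy
  | smul c x _ hx => exact hsmul c x hx

/-- Applying the regular representation to the coordinate vector of `1` recovers the coordinates of
`x`. Hence coefficients of `e_j x` can be read off from `regOp`. -/
lemma reg_single (x : X d) : reg d x (Pi.single ∅ 1) = fun S => coeff S x := by
  induction x using mono_induction with
  | hmono S =>
    rw [reg_mono]
    funext U
    rw [coeff_mono, Pi.single_apply]
    simp only [eq_comm]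
  | hadd x y hx hy =>
    rw [map_add, LinearMap.add_apply, hx, hy]
    funext S
    rw [coeff_add]
    rfl
  | hsmul c x hx =>
    rw [map_smul, LinearMap.smul_apply, hx]
    funext S
    rw [coeff_smul]
    rfl

lemma coeff_e_mul (j : Fin (d + 2)) (S : Finset (Fin (d + 2))) (x : X d) :
    coeff S (e j * x) = regCoeff j S * coeff (symmDiff S {j}) x := by
  have h := congrFun (reg_single (e j * x)) S
  rw [map_mul, Module.End.mul_apply, reg_single] at h
  rw [← h, reg, liftX_e]
  rfl

/-- The sign with which the generators `e_k` and `e_j` commute. -/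
def commSign (j k : Fin (d + 2)) : ℝ :=
  if k = j ∨ k = Fin.last (d + 1) ∨ j = Fin.last (d + 1) then 1 else -1

lemma e_mul_e_comm (j k : Fin (d + 2)) : (e k * e j : X d) = commSign j k • (e j * e k) := by
  by_cases h : k = j
  · subst h; simp [commSign]
  induction j using Fin.lastCases with
  | last => rw [commSign, if_pos (by simp), one_smul]; exact (eB_comm _).symm
  | cast j =>
    induction k using Fin.lastCases with
    | last => rw [commSign, if_pos (by simp), one_smul]; exact eB_comm _
    | cast k =>
      rw [commSign, if_neg (by simp [h, Fin.castSucc_ne_last]), neg_one_smul]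
      exact eq_neg_of_add_eq_zero_left (e_anticomm fun hjk => h (by rw [hjk]))

/-- Moving `e_j` leftwards past each factor costs one sign, which reduces right multiplication to
left multiplication. -/
lemma mono_mul_e (j : Fin (d + 2)) (S : Finset (Fin (d + 2))) :
    (mono S * e j : X d) = (∏ k ∈ S, commSign j k) • (e j * mono S) := by
  induction S using Finset.induction_on_min with
  | empty => simp [mono_empty]
  | insert a S h ih =>
    rw [mono_insert h, mul_assoc, ih, Finset.prod_insert (fun ha => lt_irrefl _ (h a ha)),
      mul_smul_comm, ← mul_assoc, e_mul_e_comm, smul_mul_assoc, smul_smul, mul_assoc, mul_comm]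

lemma coeff_mul_e (j : Fin (d + 2)) (S : Finset (Fin (d + 2))) (x : X d) :
    coeff S (x * e j) =
      (∏ k ∈ symmDiff S {j}, commSign j k) * regCoeff j S * coeff (symmDiff S {j}) x := by
  induction x using mono_induction with
  | hmono U =>
    rw [mono_mul_e, coeff_smul, coeff_e_mul, coeff_mono]
    split_ifs with h
    · rw [h, mul_assoc]
    · simp
  | hadd x y hx hy => rw [add_mul, coeff_add, hx, hy, coeff_add, mul_add]
  | hsmul c x hx => rw [smul_mul_assoc, coeff_smul, hx, coeff_smul, mul_left_comm]

/-- The skew-symmetric matrix of coefficients of the elements `e_j e_k`, `j, k ≤ d`. -/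
noncomputable def skewCoeff (x : X d) (j k : Fin d) : ℝ :=
  if j < k then coeff {j.castSucc.castSucc, k.castSucc.castSucc} x
  else if k < j then -coeff {k.castSucc.castSucc, j.castSucc.castSucc} x else 0

/-- Only the scalar term and the term in `e_j e_k` contribute. Since `e_j e_k e_k = -e_j` while `e_k
e_j e_k = e_j`, the skew part has opposite signs here and in `coeff_singleton_e_mul`; this is why
sums `a_k + p_k` appear in the system. -/
lemma coeff_singleton_mul_e (x : X d) (j k : Fin d) :
    coeff {j.castSucc.castSucc} (x * e k.castSucc.castSucc) =
      (if j = k then coeff ∅ x else 0) - skewCoeff x j k := by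
  rw [coeff_mul_e, skewCoeff]
  have hl : ∀ k : Fin d, k.castSucc.castSucc ≠ Fin.last (d + 1) := fun k => Fin.castSucc_ne_last _
  rcases lt_trichotomy j k with h | rfl | h
  · have hS : symmDiff {j.castSucc.castSucc} {k.castSucc.castSucc} =
        ({j.castSucc.castSucc, k.castSucc.castSucc} : Finset (Fin (d + 2))) := by
      ext x; simp [Finset.mem_symmDiff]; grind
    rw [hS, Finset.prod_pair (by simp [h.ne])]
    simp [h, h.ne, h.ne', regCoeff, commSign, hl]
  · simp [regCoeff, hl]
  · have hS : symmDiff {j.castSucc.castSucc} {k.castSucc.castSucc} =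
        ({k.castSucc.castSucc, j.castSucc.castSucc} : Finset (Fin (d + 2))) := by
      ext x; simp [Finset.mem_symmDiff]; grind
    rw [hS, Finset.prod_pair (by simp [h.ne])]
    simp [h, h.ne, h.ne', regCoeff, commSign, hl, h.not_gt]

lemma coeff_singleton_e_mul (x : X d) (j k : Fin d) :
    coeff {j.castSucc.castSucc} (e k.castSucc.castSucc * x) =
      (if j = k then coeff ∅ x else 0) + skewCoeff x j k := by
  rw [coeff_e_mul, skewCoeff]
  have hl : ∀ k : Fin d, k.castSucc.castSucc ≠ Fin.last (d + 1) := fun k => Fin.castSucc_ne_last _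
  rcases lt_trichotomy j k with h | rfl | h
  · have hS : symmDiff {j.castSucc.castSucc} {k.castSucc.castSucc} =
        ({j.castSucc.castSucc, k.castSucc.castSucc} : Finset (Fin (d + 2))) := by
      ext x; simp [Finset.mem_symmDiff]; grind
    rw [hS]
    simp [h, h.ne, h.ne', regCoeff, hl]
  · simp [regCoeff, hl]
  · have hS : symmDiff {j.castSucc.castSucc} {k.castSucc.castSucc} =
        ({k.castSucc.castSucc, j.castSucc.castSucc} : Finset (Fin (d + 2))) := by
      ext x; simp [Finset.mem_symmDiff]; grind
    rw [hS]
    simp [h, h.ne, h.ne', regCoeff, hl, h.not_gt]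

lemma coeff_mul_i (S : Finset (Fin (d + 2))) (x : X d) (v : EuclideanSpace ℝ (Fin d)) :
    coeff S (x * i v) = ∑ k, v k * coeff S (x * e k.castSucc.castSucc) := by
  simp only [i_apply, Finset.mul_sum, coeff_sum, mul_smul_comm, coeff_smul]

lemma coeff_singleton_mul_i (x : X d) (v : EuclideanSpace ℝ (Fin d)) (j : Fin d) :
    coeff {j.castSucc.castSucc} (x * i v) = coeff ∅ x * v j - ∑ k, skewCoeff x j k * v k := by
  rw [coeff_mul_i]
  simp [coeff_singleton_mul_e, sub_mul, mul_comm]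

lemma coeff_singleton_i_mul (x : X d) (v : EuclideanSpace ℝ (Fin d)) (j : Fin d) :
    coeff {j.castSucc.castSucc} (i v * x) = coeff ∅ x * v j + ∑ k, skewCoeff x j k * v k := by
  simp only [i_apply, Finset.sum_mul, coeff_sum, smul_mul_assoc, coeff_smul,
    coeff_singleton_e_mul]
  simp [add_mul, Finset.sum_add_distrib, mul_comm]

/-- Multiplication by `e_{d+2}` kills the monomials that contain it, as its square is zero, and
appends it to the others without a sign. -/
lemma coeff_mul_eB (x : X d) (S : Finset (Fin (d + 2))) :
    coeff S (x * eB d) = if Fin.last (d + 1) ∈ S then coeff (S.erase (Fin.last (d + 1))) x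
      else 0 := by
  rw [← eB_comm, eB, coeff_e_mul, regCoeff, if_pos rfl]
  split_ifs with h
  · rw [one_mul]
    congr 1
    ext k
    simp only [Finset.mem_symmDiff, Finset.mem_singleton, Finset.mem_erase]
    grind
  · rw [zero_mul]

/-- The coefficient of `e_j e_{d+1} e_{d+2}`. -/
noncomputable def transCoeff (x : X d) (j : Fin d) : ℝ :=
  coeff {j.castSucc.castSucc, (Fin.last d).castSucc, Fin.last (d + 1)} x

/-- Multiplying `e_j e_{d+1} e_{d+2}` by `e_{d+1}` gives `e_j e_{d+2}` on the left and `-e_j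
e_{d+2}` on the right, whence the factor 2. -/
lemma coeff_pair_eA_mul_sub (x : X d) (j : Fin d) :
    coeff {j.castSucc.castSucc, Fin.last (d + 1)} (eA d * x - x * eA d) = 2 * transCoeff x j := by
  have hl : ∀ k : Fin (d + 1), k.castSucc ≠ Fin.last (d + 1) := fun k => Fin.castSucc_ne_last _
  have h1 : j.castSucc ≠ Fin.last d := Fin.castSucc_ne_last _
  have hS : symmDiff {j.castSucc.castSucc, Fin.last (d + 1)} {(Fin.last d).castSucc} =
      ({j.castSucc.castSucc, (Fin.last d).castSucc, Fin.last (d + 1)} : Finset (Fin (d + 2))) := by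
    ext x
    have := hl (Fin.last d)
    have : j.castSucc.castSucc ≠ (Fin.last d).castSucc := by simp
    simp only [Finset.mem_symmDiff, Finset.mem_singleton, Finset.mem_insert]; grind
  rw [coeff_sub, eA, coeff_e_mul, coeff_mul_e, hS, transCoeff]
  have h2 : j.castSucc.castSucc ≠ (Fin.last d).castSucc := by simp
  have h3 : j.castSucc < Fin.last d := Fin.castSucc_lt_last _
  rw [Finset.prod_insert (by simp [h1, hl]), Finset.prod_pair (hl _), regCoeff, if_neg (hl _),
    Finset.prod_pair (hl _)]
  have h4 : ¬ Fin.last (d + 1) < (Fin.last d).castSucc := (Fin.le_last _).not_gt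
  simp [commSign, h1, h1.symm, h3, h4, hl, (hl _).symm]
  ring

/-- The equations of the transport from `a` to `p`. -/
lemma transport_equation {z : X d} {a p : EuclideanSpace ℝ (Fin d)}
    (h : z * (eB d * i a + eA d) = (eB d * i p + eA d) * z) (j : Fin d) :
    coeff ∅ z * (a j - p j) = ∑ k, skewCoeff z j k * (a k + p k) + 2 * transCoeff z j := by
  -- With `e_{d+2}` central, the transport identity becomes a formula for the commutator with
  -- `e_{d+1}`; the coefficients of `e_j e_{d+2}` on its two sides are then compared.
  have h1 : eA d * z - z * eA d = (z * i a - i p * z) * eB d := by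
    rw [eB_comm, eB_comm, mul_add, add_mul] at h
    rw [sub_mul, mul_assoc z, mul_assoc (i p), ← eB_comm z, ← mul_assoc (i p)]
    rw [sub_eq_sub_iff_add_eq_add, add_comm, ← h, add_comm]
  have h2 := coeff_pair_eA_mul_sub z j
  have hS : ({j.castSucc.castSucc, Fin.last (d + 1)} : Finset (Fin (d + 2))).erase
      (Fin.last (d + 1)) = {j.castSucc.castSucc} := by
    have := Fin.castSucc_ne_last j.castSucc
    ext; simp; grind
  rw [h1, coeff_mul_eB, if_pos (by simp), hS, coeff_sub, coeff_singleton_mul_i,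
    coeff_singleton_i_mul] at h2
  simp only [mul_add, Finset.sum_add_distrib]
  linarith

/-! ### The multiplicative structure of `Z` -/

/-- The product, in increasing order, of the elements `zGen j` with `j ∈ S`. -/
noncomputable def zMono (S : Finset (Fin (d + 1))) : X d := (S.sort.map zGen).prod

lemma zMono_insert {a : Fin (d + 1)} {S : Finset (Fin (d + 1))} (h : ∀ b ∈ S, a < b) :
    (zMono (insert a S) : X d) = zGen a * zMono S := by
  rw [zMono, Finset.sort_insert _ (fun b hb => (h b hb).le) (fun ha => lt_irrefl _ (h a ha))]
  simp [zMono]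

/-- The central factor `q` is `1` or `e_{d+2}`. It allows `e_{d+1} e_{d+2}` to be treated like the
other generators when products are swapped or squared. -/
lemma zGen_eq (j : Fin (d + 1)) :
    ∃ q : X d, (∀ x, q * x = x * q) ∧ (∃ c : ℝ, q * q = c • 1) ∧ zGen j = e j.castSucc * q := by
  by_cases h : j = Fin.last d
  · subst h
    exact ⟨eB d, eB_comm, ⟨0, by rw [eB_sq, zero_smul]⟩, by rw [zGen, if_pos rfl]; rfl⟩
  · exact ⟨1, fun x => by rw [one_mul, mul_one], ⟨1, by simp⟩, by rw [zGen, if_neg h, mul_one]⟩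

lemma zGen_swap {j k : Fin (d + 1)} (h : j ≠ k) :
    (zGen j * zGen k : X d) = (-1 : ℝ) • (zGen k * zGen j) := by
  obtain ⟨q, hq, -, hj⟩ := zGen_eq j
  obtain ⟨r, hr, -, hk⟩ := zGen_eq k
  rw [hj, hk, mul_assoc, ← mul_assoc q, hq, mul_assoc _ q r, hq r, ← mul_assoc,
    eq_neg_of_add_eq_zero_left (e_anticomm h), neg_one_smul, neg_mul, mul_assoc (e k.castSucc) r,
    ← mul_assoc r, hr (e j.castSucc)]
  simp only [mul_assoc]

lemma zGen_mul_self (j : Fin (d + 1)) : ∃ c : ℝ, (zGen j * zGen j : X d) = c • 1 := by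
  obtain ⟨q, hq, ⟨c, hc⟩, hj⟩ := zGen_eq j
  refine ⟨-c, ?_⟩
  rw [hj, mul_assoc, ← mul_assoc q, hq, mul_assoc _ q, hc, ← mul_assoc,
    eq_neg_of_add_eq_zero_left (e_sq j), mul_smul_comm, mul_one, smul_neg, neg_smul]

lemma zGen_mul_zMono (j : Fin (d + 1)) (S : Finset (Fin (d + 1))) :
    ∃ c : ℝ, (zGen j * zMono S : X d) = c • zMono (symmDiff S {j}) := by
  induction S using Finset.induction_on_min with
  | empty =>
    refine ⟨1, ?_⟩
    have : symmDiff (∅ : Finset (Fin (d + 1))) {j} = insert j ∅ := by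
      ext x; simp [Finset.mem_symmDiff]
    rw [this, zMono_insert (by simp), one_smul]
  | insert a S h ih =>
    rw [zMono_insert h]
    have haS : a ∉ S := fun ha => lt_irrefl _ (h a ha)
    rcases lt_trichotomy j a with hj | rfl | hj
    · have hj' : ∀ b ∈ insert a S, j < b := by
        intro b hb
        rcases Finset.mem_insert.1 hb with rfl | hb
        · exact hj
        · exact hj.trans (h b hb)
      have : symmDiff (insert a S) {j} = insert j (insert a S) := by
        ext x
        have := fun hx => (hj' x hx).ne'
        simp only [Finset.mem_symmDiff, Finset.mem_singleton, Finset.mem_insert] at this ⊢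
        tauto
      exact ⟨1, by rw [this, zMono_insert hj', zMono_insert h, one_smul]⟩
    · obtain ⟨c, hc⟩ := zGen_mul_self j
      have : symmDiff (insert j S) {j} = S := by
        ext x
        simp only [Finset.mem_symmDiff, Finset.mem_singleton, Finset.mem_insert]
        grind
      exact ⟨c, by rw [this, ← mul_assoc, hc, smul_mul_assoc, one_mul]⟩
    · obtain ⟨c, hc⟩ := ih
      have h1 : symmDiff (insert a S) {j} = insert a (symmDiff S {j}) := by
        ext x
        simp only [Finset.mem_symmDiff, Finset.mem_singleton, Finset.mem_insert]
        grind
      have h2 : ∀ b ∈ symmDiff S {j}, a < b := by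
        intro b hb
        simp only [Finset.mem_symmDiff, Finset.mem_singleton] at hb
        rcases hb with hb | hb
        · exact h b hb.1
        · rw [hb.1]; exact hj
      refine ⟨-1 * c, ?_⟩
      rw [h1, zMono_insert h2, ← mul_assoc, zGen_swap hj.ne', smul_mul_assoc, mul_assoc, hc,
        mul_smul_comm, smul_smul]

lemma even_card_symmDiff_singleton {n : ℕ} (S : Finset (Fin n)) (j : Fin n) :
    Even (symmDiff S {j}).card ↔ ¬ Even S.card := by
  by_cases h : j ∈ S
  · have : symmDiff S {j} = S.erase j := by ext; simp [Finset.mem_symmDiff]; grind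
    rw [this, ← Finset.card_erase_add_one h, Nat.even_add_one, not_not]
  · have : symmDiff S {j} = insert j S := by ext; simp [Finset.mem_symmDiff]; grind
    rw [this, Finset.card_insert_of_notMem h, Nat.even_add_one]

/-- The elements whose left multiplication preserves `Z d`. -/
noncomputable def zStab (d : ℕ) : Subalgebra ℝ (X d) where
  carrier := {x | ∀ y ∈ Z d, x * y ∈ Z d}
  mul_mem' hx hy z hz := by rw [mul_assoc]; exact hx _ (hy _ hz)
  add_mem' hx hy z hz := by rw [add_mul]; exact (Z d).add_mem (hx _ hz) (hy _ hz)
  algebraMap_mem' c z hz := by rw [← Algebra.smul_def]; exact (Z d).smul_mem _ hz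

/-- Membership in `Z d` is always obtained this way: `zStab d` is a subalgebra by construction, so
products need no separate closure argument. -/
lemma mem_Z_of_mem_zStab {x : X d} (hx : x ∈ zStab d) : x ∈ Z d := by
  have h1 : (1 : X d) ∈ Z d := Submodule.subset_span ⟨∅, by simp, by simp⟩
  simpa using hx 1 h1

lemma zGen_mul_zGen_mem_zStab (j k : Fin (d + 1)) : (zGen j * zGen k : X d) ∈ zStab d := by
  intro y hy
  induction hy using Submodule.span_induction with
  | mem y hy =>
    obtain ⟨S, hS, rfl⟩ := hy
    obtain ⟨c, hc⟩ := zGen_mul_zMono (d := d) k S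
    obtain ⟨c', hc'⟩ := zGen_mul_zMono (d := d) j (symmDiff S {k})
    change zGen j * zGen k * zMono S ∈ Z d
    rw [mul_assoc, hc, mul_smul_comm, hc']
    refine (Z d).smul_mem _ ((Z d).smul_mem _ (Submodule.subset_span ⟨_, ?_, rfl⟩))
    rw [even_card_symmDiff_singleton, even_card_symmDiff_singleton]
    exact not_not.2 hS
  | zero => simp
  | add x y _ _ hx hy => rw [mul_add]; exact (Z d).add_mem hx hy
  | smul c x _ hx => rw [mul_smul_comm]; exact (Z d).smul_mem c hx

lemma zGen_castSucc (j : Fin d) : (zGen j.castSucc : X d) = e j.castSucc.castSucc := by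
  rw [zGen, if_neg (Fin.castSucc_ne_last j)]

lemma i_mul_zGen_mem_zStab (v : EuclideanSpace ℝ (Fin d)) (k : Fin (d + 1)) :
    (i v * zGen k : X d) ∈ zStab d := by
  rw [i_apply, Finset.sum_mul]
  refine Subalgebra.sum_mem _ fun j _ => ?_
  rw [smul_mul_assoc, ← zGen_castSucc]
  exact Subalgebra.smul_mem _ (zGen_mul_zGen_mem_zStab _ _) _

/-! ### Supports -/

/-- `x` is a combination of products of the generators with index (from `0`) less than `m`. -/
def SupportedBelow (m : ℕ) (x : X d) : Prop :=
  ∀ S : Finset (Fin (d + 2)), (∃ k ∈ S, m ≤ (k : ℕ)) → coeff S x = 0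

lemma SupportedBelow.mul_e {m : ℕ} {x : X d} (hx : SupportedBelow m x) {k : Fin (d + 2)}
    (hk : (k : ℕ) < m) : SupportedBelow m (x * e k) := by
  rintro S ⟨l, hl, hml⟩
  have hlk : l ≠ k := by rintro rfl; omega
  rw [coeff_mul_e, hx _ ⟨l, (mem_symmDiff_ne S hlk).2 hl, hml⟩, mul_zero]

lemma SupportedBelow.mono {m n : ℕ} {x : X d} (hx : SupportedBelow m x) (h : m ≤ n) :
    SupportedBelow n x := fun S ⟨k, hk, hm⟩ => hx S ⟨k, hk, h.trans hm⟩

lemma SupportedBelow.add {m : ℕ} {x y : X d} (hx : SupportedBelow m x)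
    (hy : SupportedBelow m y) : SupportedBelow m (x + y) := fun S hS => by
  rw [coeff_add, hx S hS, hy S hS, add_zero]

lemma SupportedBelow.mul_i {m : ℕ} {x : X d} (hx : SupportedBelow m x)
    {w : EuclideanSpace ℝ (Fin d)} (hw : ∀ j : Fin d, m ≤ (j : ℕ) → w j = 0) :
    SupportedBelow m (x * i w) := by
  intro S hS
  rw [coeff_mul_i]
  refine Finset.sum_eq_zero fun k _ => ?_
  rcases le_or_gt m k with hk | hk
  · rw [hw k hk, zero_mul]
  · rw [hx.mul_e (k := k.castSucc.castSucc) hk S hS, mul_zero]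

/-- In `y e_m`, with `y` a combination of products of generators preceding `e_m`, the monomials that
do not contain `e_m` do not occur. -/
lemma SupportedBelow.coeff_mul_e_of_notMem {x : X d} {k : Fin (d + 2)}
    (hx : SupportedBelow k x) {S : Finset (Fin (d + 2))} (hS : k ∉ S) :
    coeff S (x * e k) = 0 := by
  rw [coeff_mul_e, hx _ ⟨k, (mem_symmDiff_self S k).2 hS, le_rfl⟩, mul_zero]

lemma skewCoeff_swap (x : X d) (j k : Fin d) : skewCoeff x k j = -skewCoeff x j k := by
  rcases lt_trichotomy j k with h | rfl | h
  · simp [skewCoeff, h, h.not_gt]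
  · simp [skewCoeff]
  · simp [skewCoeff, h, h.not_gt]

lemma skewCoeff_add (x y : X d) (j k : Fin d) :
    skewCoeff (x + y) j k = skewCoeff x j k + skewCoeff y j k := by
  simp only [skewCoeff, coeff_add]
  split_ifs <;> ring

/-- The only contribution is `e_j` times `e_m`, already in increasing order, so there is no sign. -/
lemma coeff_pair_mul_e (x : X d) {j m : Fin d} (h : j < m) :
    coeff {j.castSucc.castSucc, m.castSucc.castSucc} (x * e m.castSucc.castSucc) =
      coeff {j.castSucc.castSucc} x := by
  have hl : ∀ k : Fin d, k.castSucc.castSucc ≠ Fin.last (d + 1) := fun k => Fin.castSucc_ne_last _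
  have hS : symmDiff {j.castSucc.castSucc, m.castSucc.castSucc} {m.castSucc.castSucc} =
      ({j.castSucc.castSucc} : Finset (Fin (d + 2))) := by
    have : j.castSucc.castSucc ≠ m.castSucc.castSucc := by simpa using h.ne
    ext x
    simp only [Finset.mem_symmDiff, Finset.mem_singleton, Finset.mem_insert]
    grind
  rw [coeff_mul_e, hS, regCoeff, if_neg (hl m), Finset.prod_pair (by simpa using h.ne)]
  simp [commSign, h, h.ne, hl]

/-! ### The rotor with prescribed 2-terms -/

/-- The Cayley-type equation: `1 - A` is invertible for skew-symmetric `A`. -/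
lemma exists_sub_skew_eq {A : Fin d → Fin d → ℝ} (hA : ∀ j k, A k j = -A j k) (b : Fin d → ℝ) :
    ∃ w : EuclideanSpace ℝ (Fin d), ∀ j, w j - ∑ k, A j k * w k = b j := by
  let M : (Fin d → ℝ) →ₗ[ℝ] (Fin d → ℝ) := (1 - Matrix.of A).mulVecLin
  have hM : ∀ w j, M w j = w j - ∑ k, A j k * w k := by
    intro w j
    simp [M, Matrix.mulVec, dotProduct]
  have hinj : Function.Injective M := by
    refine (injective_iff_map_eq_zero M).2 fun w hw => ?_
    -- The quadratic form of a skew-symmetric matrix vanishes, so `w = A w` forces `|w|² = 0`.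
    have h1 : ∑ j, ∑ k, w j * (A j k * w k) = 0 := by
      have h2 : ∑ j, ∑ k, w j * (A j k * w k) = -∑ j, ∑ k, w j * (A j k * w k) := by
        conv_lhs => rw [Finset.sum_comm]
        simp only [← Finset.sum_neg_distrib]
        refine Finset.sum_congr rfl fun j _ => Finset.sum_congr rfl fun k _ => ?_
        rw [hA j k]
        ring
      linarith
    have h3 : ∑ j, w j * w j = 0 := by
      have h4 : ∀ j, w j * w j = ∑ k, w j * (A j k * w k) := fun j => by
        have := congrFun hw j
        rw [hM, Pi.zero_apply, sub_eq_zero] at this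
        rw [← Finset.mul_sum, ← this]
      rw [← h1]
      exact Finset.sum_congr rfl fun j _ => h4 j
    rw [Finset.sum_eq_zero_iff_of_nonneg fun j _ => mul_self_nonneg _] at h3
    exact funext fun j => mul_self_eq_zero.1 (h3 j (Finset.mem_univ j))
  obtain ⟨w, hw⟩ := LinearMap.injective_iff_surjective.1 hinj b
  exact ⟨WithLp.toLp 2 w, fun j => by rw [← hw, hM]⟩

/-- An unnormalized rotation: its norm is a positive scalar, it conjugates vectors to vectors, and
it lies in the even part of the Clifford algebra of `ℝ^d`. -/
structure IsRotor (s : X d) : Prop where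
  norm : ∃ r : ℝ, 0 < r ∧ s * conj s = r • 1
  vec : ∀ v : EuclideanSpace ℝ (Fin d), ∃ w : EuclideanSpace ℝ (Fin d), s * i v * conj s = i w
  comm : s * eA d = eA d * s
  stab : s ∈ zStab d

lemma IsRotor.one : IsRotor (1 : X d) where
  norm := ⟨1, one_pos, by rw [conj_one, one_mul, one_smul]⟩
  vec v := ⟨v, by rw [conj_one, one_mul, mul_one]⟩
  comm := by rw [one_mul, mul_one]
  stab := one_mem _

lemma IsRotor.mul {s t : X d} (hs : IsRotor s) (ht : IsRotor t) : IsRotor (s * t) where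
  norm := by
    obtain ⟨r, hr, h⟩ := hs.norm
    obtain ⟨r', hr', h'⟩ := ht.norm
    refine ⟨r' * r, mul_pos hr' hr, ?_⟩
    rw [conj_mul, mul_assoc, ← mul_assoc t, h', smul_mul_assoc, one_mul, mul_smul_comm, h, smul_smul]
  vec v := by
    obtain ⟨w, hw⟩ := ht.vec v
    obtain ⟨u, hu⟩ := hs.vec w
    refine ⟨u, ?_⟩
    rw [conj_mul, ← hu, ← hw]
    simp only [mul_assoc]
  comm := by rw [mul_assoc, ht.comm, ← mul_assoc, hs.comm, mul_assoc]
  stab := mul_mem hs.stab ht.stab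

/-- Write `f = e_m`. Since `w ⊥ f`, the cross terms `wf + fw` of `(1 + wf)(1 + fw)` cancel, and `w
f² w = |w|²` leaves the positive norm `1 + |w|²`. -/
lemma isRotor_one_add {w : EuclideanSpace ℝ (Fin d)} {m : Fin d} (hw : w m = 0) :
    IsRotor (1 + i w * e m.castSucc.castSucc : X d) := by
  have hc : conj (1 + i w * e m.castSucc.castSucc : X d) = 1 + e m.castSucc.castSucc * i w := by
    rw [conj_add, conj_one, conj_mul, conj_i, conj_e_castSucc, neg_mul_neg]
  have hf := i_single (d := d) m
  set f := EuclideanSpace.single m (1 : ℝ) with hf'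
  have hwf : inner ℝ w f = 0 := by rw [hf', EuclideanSpace.inner_single_right]; simp [hw]
  have hff : inner ℝ f f = 1 := by simp [hf']
  refine ⟨⟨1 + inner ℝ w w, by have := real_inner_self_nonneg (x := w); linarith, ?_⟩,
    fun v => ?_, ?_, ?_⟩
  · rw [hc, ← hf]
    have h1 : (i w * i f + i f * i w : X d) = 0 := by rw [i_mul_i_add, hwf]; simp
    have h2 : (1 + i w * i f) * (1 + i f * i w) =
        (1 + (i w * i f + i f * i w) + i w * (i f * i f) * i w : X d) := by noncomm_ring
    rw [h2, h1, i_mul_self, hff, neg_one_smul, mul_neg_one, neg_mul, i_mul_self, neg_smul, add_smul,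
      one_smul, neg_neg, add_zero]
  · rw [hc, ← hf]
    exact rotor_sandwich w f v
  · rw [← hf, add_mul, mul_add, one_mul, mul_one, mul_assoc, ← mul_assoc (eA d), eA_mul_i, neg_mul,
      mul_assoc, eA_mul_i, mul_neg, neg_neg]
  · rw [← zGen_castSucc]
    exact add_mem (one_mem _) (i_mul_zGen_mem_zStab _ _)

/-- The matrix is filled in one column at a time. Multiplying `s` on the right by `1 + w e_m`, with
`w` in the span of the earlier basis vectors, adds only monomials containing `e_m`, so the earlier
coefficients survive. The new coefficients of `e_j e_m` are the vector coefficients of `s w`, namely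
those of `(1 - A') w` with `A'` the skew matrix of `s`; as `1 - A'` is invertible, they can be
prescribed. -/
lemma exists_isRotor_below {A : Fin d → Fin d → ℝ} (hA : ∀ j k, A k j = -A j k) (m : ℕ)
    (hm : m ≤ d) :
    ∃ s : X d, IsRotor s ∧ SupportedBelow m s ∧ coeff ∅ s = 1 ∧
      ∀ j k : Fin d, skewCoeff s j k = if (j : ℕ) < m ∧ (k : ℕ) < m then A j k else 0 := by
  induction m with
  | zero =>
    have h1 : ∀ S : Finset (Fin (d + 2)), S ≠ ∅ → coeff S (1 : X d) = 0 := fun S hS => by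
      rw [← mono_empty, coeff_mono, if_neg hS.symm]
    refine ⟨1, IsRotor.one, fun S ⟨k, hk, _⟩ => h1 S (Finset.ne_empty_of_mem hk), ?_, fun j k => ?_⟩
    · rw [← mono_empty, coeff_mono, if_pos rfl]
    · simp [skewCoeff, h1]
  | succ n ih =>
    obtain ⟨s, hs, hsupp, hs1, hskew⟩ := ih (by omega)
    let m : Fin d := ⟨n, hm⟩
    have hsk : ∀ j k, skewCoeff s k j = -skewCoeff s j k := skewCoeff_swap s
    obtain ⟨w, hw⟩ := exists_sub_skew_eq hsk fun j => if (j : ℕ) < n then A j m else 0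
    -- Rows of the skew matrix of `s` with index at least `n` are zero, so there the equation for
    -- `w` reads `w j = 0`.
    have hw0 : ∀ j : Fin d, n ≤ (j : ℕ) → w j = 0 := by
      intro j hj
      have h := hw j
      simp only [hskew, hj.not_gt, false_and, if_false, zero_mul, Finset.sum_const_zero,
        sub_zero] at h
      exact h
    have hy : SupportedBelow n (s * i w) := hsupp.mul_i hw0
    refine ⟨s * (1 + i w * e m.castSucc.castSucc), hs.mul (isRotor_one_add (hw0 m le_rfl)), ?_⟩
    rw [mul_add, mul_one, ← mul_assoc]
    refine ⟨(hsupp.mono n.le_succ).add ((hy.mono n.le_succ).mul_e (Nat.lt_succ_self n)), ?_, ?_⟩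
    · rw [coeff_add, hs1, SupportedBelow.coeff_mul_e_of_notMem (k := m.castSucc.castSucc) hy
        (Finset.notMem_empty _), add_zero]
    · have key : ∀ j k : Fin d, j < k →
          skewCoeff (s + s * i w * e m.castSucc.castSucc) j k =
            if (j : ℕ) < n + 1 ∧ (k : ℕ) < n + 1 then A j k else 0 := by
        intro j k hjk
        have hjk' : (j : ℕ) < k := hjk
        rw [skewCoeff_add, hskew]
        rcases lt_trichotomy k m with h | rfl | h
        · have h' : (k : ℕ) < n := h
          rw [if_pos ⟨by omega, h'⟩, if_pos ⟨by omega, by omega⟩, skewCoeff, if_pos hjk,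
            SupportedBelow.coeff_mul_e_of_notMem (k := m.castSucc.castSucc) hy, add_zero]
          simp [h.ne', (hjk.trans h).ne']
        -- This is the new column: the coefficient of `e_j` in `s w` is the left side of the
        -- equation defining `w`.
        · rw [if_neg (fun h => lt_irrefl _ h.2), if_pos ⟨hjk'.trans (Nat.lt_succ_self n), Nat.lt_succ_self n⟩,
            skewCoeff, if_pos hjk, coeff_pair_mul_e _ hjk, coeff_singleton_mul_i, hs1, one_mul, hw,
            if_pos hjk', zero_add]
        · have h' : n < (k : ℕ) := h
          rw [if_neg (by omega), if_neg (by omega), skewCoeff, if_pos hjk,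
            (hy.mono n.le_succ).mul_e (k := m.castSucc.castSucc) (Nat.lt_succ_self n) _
              ⟨k.castSucc.castSucc, by simp, h'⟩, add_zero]
      intro j k
      rcases lt_trichotomy j k with h | rfl | h
      · exact key j k h
      · have : A j j = 0 := by linarith [hA j j]
        simp [skewCoeff, this]
      · rw [skewCoeff_swap _ k j, key k j h, hA k j]
        split_ifs <;> grind

lemma exists_isRotor {A : Fin d → Fin d → ℝ} (hA : ∀ j k, A k j = -A j k) :
    ∃ s : X d, IsRotor s ∧ coeff ∅ s = 1 ∧ ∀ j k, skewCoeff s j k = A j k := by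
  obtain ⟨s, hs, -, h1, h2⟩ := exists_isRotor_below hA d le_rfl
  exact ⟨s, hs, h1, fun j k => by rw [h2, if_pos ⟨j.2, k.2⟩]⟩

/-! ### Translations, and the elements of `Spun d` -/

/-- The element of `Spun d` that acts as the translation by `-b`. -/
noncomputable def translator (b : EuclideanSpace ℝ (Fin d)) : X d :=
  1 + (1 / 2 : ℝ) • (i b * eA d) * eB d

lemma conj_translator (b : EuclideanSpace ℝ (Fin d)) :
    conj (translator b) = 1 - (1 / 2 : ℝ) • (i b * eA d) * eB d := by
  rw [translator, conj_add, conj_one, conj_mul, conj_smul, conj_mul, conj_eA, conj_eB, conj_i,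
    neg_mul_neg, eA_mul_i, eB_comm, smul_neg, neg_mul, sub_eq_add_neg]

lemma mul_eB_mul_mul_eB (x y : X d) : x * eB d * (y * eB d) = 0 := by
  rw [mul_assoc, ← mul_assoc (eB d), eB_comm y, mul_assoc y, eB_sq, mul_zero, mul_zero]

lemma translator_mul_conj (b : EuclideanSpace ℝ (Fin d)) :
    translator b * conj (translator b) = 1 := by
  rw [conj_translator, translator, add_mul, mul_sub, mul_sub, mul_eB_mul_mul_eB]
  simp

/-- Terms with two factors `e_{d+2}` vanish. What remains beyond the original element is the
commutator of `(1/2) b e_{d+1}` with `e_{d+1}`, which equals `-b`, times `e_{d+2}`. -/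
lemma translator_sandwich (b v : EuclideanSpace ℝ (Fin d)) :
    translator b * (eB d * i v + eA d) * conj (translator b) = eB d * i (v - b) + eA d := by
  have h1 : eA d * (i b * eA d) = i b := by
    rw [← mul_assoc, eA_mul_i, neg_mul, mul_assoc, eA_sq, mul_neg_one, neg_neg]
  have h2 : i b * eA d * eA d = -i b := by rw [mul_assoc, eA_sq, mul_neg_one]
  rw [conj_translator, translator, eB_comm, eB_comm]
  set y := (1 / 2 : ℝ) • (i b * eA d) with hy
  have h3 : y * eA d - eA d * y = -i b := by
    rw [hy, smul_mul_assoc, mul_smul_comm, h1, h2, ← smul_sub, ← neg_add', ← two_smul ℝ (i b),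
      smul_neg, smul_smul]
    norm_num
  have h4 : (1 + y * eB d) * (i v * eB d + eA d) * (1 - y * eB d) =
      i v * eB d + eA d + (y * (eB d * eA d) - eA d * y * eB d) +
      (y * eB d * (i v * eB d) - i v * eB d * (y * eB d) -
        y * eB d * (i v * eB d) * (y * eB d) - y * (eB d * eA d * y) * eB d) := by noncomm_ring
  rw [h4, mul_eB_mul_mul_eB, mul_eB_mul_mul_eB, zero_mul, mul_assoc (eB d), eB_comm (eA d * y),
    eB_comm (eA d), ← mul_assoc y (eA d), ← sub_mul, h3]
  have h5 : y * (eA d * y * eB d) * eB d = 0 := by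
    rw [mul_assoc, mul_assoc _ (eB d), eB_sq, mul_zero, mul_zero]
  rw [h5, map_sub, sub_mul, neg_mul]
  abel

lemma translator_mem_zStab (b : EuclideanSpace ℝ (Fin d)) : translator b ∈ zStab d := by
  have h : (zGen (Fin.last d) : X d) = eA d * eB d := by rw [zGen, if_pos rfl]
  refine add_mem (one_mem _) ?_
  rw [smul_mul_assoc, mul_assoc, ← h]
  exact Subalgebra.smul_mem _ (i_mul_zGen_mem_zStab _ _) _

/-- The translator is `1` plus a multiple of the central `e_{d+2}`, so it alters only coefficients
of monomials containing `e_{d+2}`. -/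
lemma coeff_translator_mul (b : EuclideanSpace ℝ (Fin d)) (s : X d) {S : Finset (Fin (d + 2))}
    (hS : Fin.last (d + 1) ∉ S) : coeff S (translator b * s) = coeff S s := by
  rw [translator, add_mul, one_mul, coeff_add, mul_assoc, eB_comm, ← mul_assoc, coeff_mul_eB,
    if_neg hS, add_zero]

/-- Conjugation by `s` multiplies `e_{d+1}` by its norm `r` and keeps vectors vectors. Scaling by
`1/√r` therefore gives an element of `Spun d`, and a translation corrects the image of `a`. -/
lemma IsRotor.exists_smul_translator_mul_mem_T {s : X d} (hs : IsRotor s)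
    (a p : EuclideanSpace ℝ (Fin d)) :
    ∃ (c : ℝ) (b : EuclideanSpace ℝ (Fin d)), 0 < c ∧ c • (translator b * s) ∈ T a p := by
  obtain ⟨r, hr, hN⟩ := hs.norm
  have hc : (√r)⁻¹ * (√r)⁻¹ * r = 1 := by
    rw [← mul_inv, Real.mul_self_sqrt hr.le, inv_mul_cancel₀ hr.ne']
  set c := (√r)⁻¹
  have hact : ∀ b v w : EuclideanSpace ℝ (Fin d), s * i v * conj s = i w →
      c • (translator b * s) * (eB d * i v + eA d) * conj (c • (translator b * s)) =
        eB d * i (r⁻¹ • w - b) + eA d := by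
    intro b v w hw
    have h1 : s * (eB d * i v + eA d) * conj s = r • (eB d * i (r⁻¹ • w) + eA d) := by
      rw [mul_add, add_mul, hs.comm, mul_assoc (eA d), hN, ← mul_assoc, ← eB_comm s, mul_assoc,
        mul_assoc, ← mul_assoc s, hw, map_smul, mul_smul_comm, mul_one, smul_add, mul_smul_comm,
        smul_smul, mul_inv_cancel₀ hr.ne', one_smul]
    rw [conj_smul, conj_mul, smul_mul_assoc, smul_mul_assoc, mul_smul_comm, smul_smul,
      ← mul_assoc, mul_assoc _ s, mul_assoc _ (s * _), h1, mul_smul_comm, smul_mul_assoc, smul_smul,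
      hc, one_smul, translator_sandwich]
  obtain ⟨q, hq⟩ := hs.vec a
  -- The normalized rotor takes `a` to `r⁻¹ q`, and `translator b` subtracts `b`; this `b` makes the
  -- result `p`.
  refine ⟨c, r⁻¹ • q - p, inv_pos.2 (Real.sqrt_pos.2 hr), ⟨?_, ?_, fun v => ?_⟩, ?_⟩
  · exact mem_Z_of_mem_zStab
      (Subalgebra.smul_mem _ (mul_mem (translator_mem_zStab _) hs.stab) _)
  · rw [N, conj_smul, conj_mul, smul_mul_smul_comm, mul_assoc, ← mul_assoc s, hN, smul_mul_assoc,
      one_mul, mul_smul_comm, translator_mul_conj, smul_smul, hc, one_smul]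
  · obtain ⟨w, hw⟩ := hs.vec v
    exact ⟨_, hact _ v w hw⟩
  · rw [act, hact _ a q hq, tau_apply, sub_sub_cancel]

/-- In a finite-dimensional algebra a one-sided inverse is two-sided. -/
lemma conj_mul_self_of_N_eq_one {z : X d} (h : N z = 1) : conj z * z = 1 := by
  have : FiniteDimensional ℝ (X d) := Module.Finite.of_basis (stdBasis d)
  have : IsNoetherianRing (X d) := isNoetherian_of_tower ℝ inferInstance
  exact mul_eq_one_comm.1 h

lemma transport_of_mem_T {z : X d} {a p : EuclideanSpace ℝ (Fin d)} (hz : z ∈ T a p) :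
    z * (eB d * i a + eA d) = (eB d * i p + eA d) * z := by
  obtain ⟨⟨-, hN, hz⟩, rfl⟩ := hz
  obtain ⟨w, hw⟩ := hz a
  rw [act, hw, tau_apply, ← hw, mul_assoc _ (conj z), conj_mul_self_of_N_eq_one hN, mul_one]

/-! ### The linear system -/

/-- The skew-symmetric matrix of the coordinates `x_{j,k}`, `k ≤ d`. -/
noncomputable def skewPart (x : EuclideanSpace ℝ (Pair d)) (j k : Fin d) : ℝ :=
  if h : j < k then x ⟨(j.castSucc, k.castSucc), Fin.castSucc_lt_castSucc_iff.2 h⟩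
  else if h : k < j then -x ⟨(k.castSucc, j.castSucc), Fin.castSucc_lt_castSucc_iff.2 h⟩ else 0

lemma skewPart_swap (x : EuclideanSpace ℝ (Pair d)) (j k : Fin d) :
    skewPart x k j = -skewPart x j k := by
  rcases lt_trichotomy j k with h | rfl | h
  · simp [skewPart, h, h.not_gt]
  · simp [skewPart]
  · simp [skewPart, h, h.not_gt]

/-- The right hand side of the system, as a linear map in `x`. -/
noncomputable def systemMap (q : EuclideanSpace ℝ (Fin d)) :
    EuclideanSpace ℝ (Pair d) →ₗ[ℝ] (Fin d → ℝ) where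
  toFun x j := ∑ k, skewPart x j k * q k + 2 * x ⟨(j.castSucc, Fin.last d), Fin.castSucc_lt_last j⟩
  map_add' x y := by
    funext j
    have h : ∀ k, skewPart (x + y) j k = skewPart x j k + skewPart y j k := fun k => by
      simp only [skewPart, PiLp.add_apply]
      split_ifs <;> ring
    simp only [h, add_mul, Finset.sum_add_distrib, PiLp.add_apply, Pi.add_apply]
    ring
  map_smul' c x := by
    funext j
    have h : ∀ k, skewPart (c • x) j k = c * skewPart x j k := fun k => by
      simp only [skewPart, PiLp.smul_apply, smul_eq_mul]
      split_ifs <;> ring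
    simp only [h, mul_assoc, ← Finset.mul_sum, PiLp.smul_apply, Pi.smul_apply, smul_eq_mul,
      RingHom.id_apply]
    ring

lemma systemMap_apply (q : EuclideanSpace ℝ (Fin d)) (x : EuclideanSpace ℝ (Pair d)) (j : Fin d) :
    systemMap q x j =
      ∑ k, skewPart x j k * q k + 2 * x ⟨(j.castSucc, Fin.last d), Fin.castSucc_lt_last j⟩ := rfl

lemma sum_skewPart_mul (x : EuclideanSpace ℝ (Pair d)) (q : Fin d → ℝ) (j : Fin d) :
    ∑ k, skewPart x j k * q k =
      ∑ k : {k : Fin d // j < k},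
          q k * x ⟨(j.castSucc, k.1.castSucc), Fin.castSucc_lt_castSucc_iff.2 k.2⟩
        - ∑ k : {k : Fin d // k < j},
          q k * x ⟨(k.1.castSucc, j.castSucc), Fin.castSucc_lt_castSucc_iff.2 k.2⟩ := by
  have h1 : ∑ k : {k : Fin d // j < k},
      q k * x ⟨(j.castSucc, k.1.castSucc), Fin.castSucc_lt_castSucc_iff.2 k.2⟩ =
      ∑ k, if j < k then skewPart x j k * q k else 0 := by
    rw [← Finset.sum_filter, ← Finset.sum_subtype_eq_sum_filter, Finset.subtype_univ]
    refine Finset.sum_congr rfl fun k _ => ?_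
    rw [skewPart, dif_pos k.2, mul_comm]
  have h2 : ∑ k : {k : Fin d // k < j},
      q k * x ⟨(k.1.castSucc, j.castSucc), Fin.castSucc_lt_castSucc_iff.2 k.2⟩ =
      ∑ k, if k < j then -(skewPart x j k * q k) else 0 := by
    rw [← Finset.sum_filter, ← Finset.sum_subtype_eq_sum_filter, Finset.subtype_univ]
    refine Finset.sum_congr rfl fun k _ => ?_
    rw [skewPart, dif_neg k.2.not_gt, dif_pos k.2]
    ring
  rw [h1, h2, ← Finset.sum_sub_distrib]
  refine Finset.sum_congr rfl fun k _ => ?_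
  rcases lt_trichotomy j k with h | rfl | h
  · simp [h, h.not_gt]
  · simp [skewPart]
  · simp [h, h.not_gt]

/-- The coordinates `x_{j,d+1}` alone suffice: take them to be `b_j / 2` and all others zero. -/
lemma systemMap_surjective (q : EuclideanSpace ℝ (Fin d)) : Function.Surjective (systemMap q) := by
  intro b
  refine ⟨WithLp.toLp 2 fun r => if h : r.1.2 = Fin.last d then
    b (r.1.1.castPred (r.2.trans_le (Fin.le_last _)).ne) / 2 else 0, ?_⟩
  funext j
  rw [systemMap_apply, Finset.sum_eq_zero, zero_add]
  · simp
    ring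
  · intro k _
    simp [skewPart, Fin.castSucc_ne_last]

lemma card_pair (d : ℕ) : Fintype.card (Pair d) = (d + 1).choose 2 := by
  rw [Fintype.card_subtype, ← Finset.univ_product_univ, Finset.card_product_filter_lt,
    Finset.card_univ, Fintype.card_fin]

lemma finrank_ker_systemMap (q : EuclideanSpace ℝ (Fin d)) :
    Module.finrank ℝ (LinearMap.ker (systemMap q)) = d.choose 2 := by
  have h := (systemMap q).finrank_range_add_finrank_ker
  rw [LinearMap.range_eq_top.2 (systemMap_surjective q), finrank_top, Module.finrank_fin_fun,
    -- Rank-nullity combines with Pascal's rule `(d+1).choose 2 = d + d.choose 2`.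
    finrank_euclideanSpace, card_pair, Nat.choose_succ_succ' d 1, Nat.choose_one_right] at h
  exact Nat.add_left_cancel h

/-! ### The image of `eta` -/

lemma skewPart_eta (z : X d) (j k : Fin d) :
    skewPart (eta z) j k = (coeff ∅ z)⁻¹ * skewCoeff z j k := by
  simp only [skewPart, skewCoeff, eta, twoTerm, Fin.castSucc_ne_last, if_false, coeff_smul]
  split_ifs <;> ring

lemma eta_last (z : X d) (j : Fin d) :
    eta z ⟨(j.castSucc, Fin.last d), Fin.castSucc_lt_last j⟩ = (coeff ∅ z)⁻¹ * transCoeff z j := by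
  simp only [eta, twoTerm, if_true, coeff_smul, transCoeff]

lemma systemMap_eta {a p : EuclideanSpace ℝ (Fin d)} {z : X d} (hz : z ∈ T a p)
    (h0 : coeff ∅ z ≠ 0) : systemMap (a + p) (eta z) = fun j => a j - p j := by
  funext j
  have h := transport_equation (transport_of_mem_T hz) j
  simp only [systemMap_apply, skewPart_eta, eta_last, mul_assoc, ← Finset.mul_sum, PiLp.add_apply]
  rw [mul_left_comm, ← mul_add, ← h, inv_mul_cancel_left₀ h0]

lemma ext_pair {x y : EuclideanSpace ℝ (Pair d)} (h1 : ∀ j k, skewPart x j k = skewPart y j k)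
    (h2 : ∀ j : Fin d, x ⟨(j.castSucc, Fin.last d), Fin.castSucc_lt_last j⟩ =
      y ⟨(j.castSucc, Fin.last d), Fin.castSucc_lt_last j⟩) : x = y := by
  ext ⟨⟨j, k⟩, h⟩
  have h : j < k := h
  obtain ⟨j, rfl⟩ := Fin.exists_castSucc_eq.2 (h.trans_le (Fin.le_last _)).ne
  induction k using Fin.lastCases with
  | last => exact h2 j
  | cast k =>
    have hjk : j < k := Fin.castSucc_lt_castSucc_iff.1 h
    simpa [skewPart, hjk] using h1 j k

lemma eta_image (a p : EuclideanSpace ℝ (Fin d)) :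
    eta '' (T a p ∩ SpunPos d) = {x | systemMap (a + p) x = fun j => a j - p j} := by
  ext x
  constructor
  · rintro ⟨z, ⟨hz, hpos⟩, rfl⟩
    exact systemMap_eta hz hpos.2.ne'
  · intro hx
    obtain ⟨s, hs, hs1, hsA⟩ := exists_isRotor (skewPart_swap x)
    obtain ⟨c, b, hc, hz⟩ := hs.exists_smul_translator_mul_mem_T a p
    have h1 : coeff ∅ (c • (translator b * s)) = c := by
      rw [coeff_smul, coeff_translator_mul b s (Finset.notMem_empty _), hs1, mul_one]
    refine ⟨_, ⟨hz, hz.1, by rwa [h1]⟩, ?_⟩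
    have h2 : ∀ j k, skewPart (eta (c • (translator b * s))) j k = skewPart x j k := by
      intro j k
      have hl : ∀ k : Fin d, Fin.last (d + 1) ≠ k.castSucc.castSucc :=
        fun k => (Fin.castSucc_ne_last _).symm
      have h3 : skewCoeff (c • (translator b * s)) j k = c * skewCoeff s j k := by
        simp only [skewCoeff, coeff_smul]
        rw [coeff_translator_mul b s (by simp [hl]), coeff_translator_mul b s (by simp [hl])]
        split_ifs <;> ring
      rw [skewPart_eta, h1, h3, inv_mul_cancel_left₀ hc.ne', hsA]
    -- Both points solve the system and share their skew parts, so the `j`-th equation forces equal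
    -- last coordinates.
    refine ext_pair h2 fun j => ?_
    have h3 := congrFun ((systemMap_eta hz (by rw [h1]; exact hc.ne')).trans hx.symm) j
    simp only [systemMap_apply, h2] at h3
    linarith

end SpunGroup

/-! ### The solution set as an affine subspace -/

theorem theorem6p1 (d : ℕ) (a p : EuclideanSpace ℝ (Fin d)) :
    (∃ L : AffineSubspace ℝ (EuclideanSpace ℝ (SpunGroup.Pair d)),
      (L : Set (EuclideanSpace ℝ (SpunGroup.Pair d))) =
          SpunGroup.eta '' (SpunGroup.T a p ∩ SpunGroup.SpunPos d) ∧
        (L : Set (EuclideanSpace ℝ (SpunGroup.Pair d))).Nonempty ∧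
        Module.finrank ℝ L.direction = d.choose 2) ∧
    SpunGroup.eta '' (SpunGroup.T a p ∩ SpunGroup.SpunPos d) =
      {x : EuclideanSpace ℝ (SpunGroup.Pair d) | ∀ j : Fin d,
        a j - p j =
          ∑ k : {k : Fin d // j < k},
              (a k + p k) * x ⟨(j.castSucc, k.1.castSucc), Fin.castSucc_lt_castSucc_iff.2 k.2⟩
            - ∑ k : {k : Fin d // k < j},
              (a k + p k) * x ⟨(k.1.castSucc, j.castSucc), Fin.castSucc_lt_castSucc_iff.2 k.2⟩
            + 2 * x ⟨(j.castSucc, Fin.last d), Fin.castSucc_lt_last j⟩} := by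
  rw [SpunGroup.eta_image]
  refine ⟨?_, ?_⟩
  · obtain ⟨x₀, hx₀⟩ := SpunGroup.systemMap_surjective (a + p) fun j => a j - p j
    -- The solutions form the translate by `x₀` of the kernel of the surjective map `systemMap (a +
    -- p)`.
    refine ⟨AffineSubspace.mk' x₀ (LinearMap.ker (SpunGroup.systemMap (a + p))), ?_,
      ⟨x₀, AffineSubspace.self_mem_mk' _ _⟩, ?_⟩
    · ext x
      rw [SetLike.mem_coe, AffineSubspace.mem_mk', vsub_eq_sub, LinearMap.mem_ker, map_sub,
        sub_eq_zero, hx₀]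
      rfl
    · rw [AffineSubspace.direction_mk', SpunGroup.finrank_ker_systemMap]
  · ext x
    refine funext_iff.trans (forall_congr' fun j => ?_)
    rw [SpunGroup.systemMap_apply, SpunGroup.sum_skewPart_mul, eq_comm]
    rfl
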